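/- Let $T$ be an associative ring with identity $1\neq 0$ which is left Artinian and integral over its center $C(T)$ (that is, every element of $T$ is a root of a monic polynomial with coefficients in $C(T)$). Then either $T$ has a maximal subring, that is, a subring $R\subsetneq T$ containing $1_T$ such that no subring of $T$ lies strictly between $R$ and $T$; or $T$ is countable (finite or countably infinite), has nonzero characteristic $n$, and is integral over its prime subring $\{k\cdot 1_T \mid k\in\mathbb{Z}\}\cong\mathbb{Z}_n$ (that is, every element of $T$ is a root of a monic polynomial with coefficients in the prime subring). -/

import Mathlib

/-- The prime subring `{n · 1 | n ∈ ℤ}` of a ring `T`. -/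
def primeSubring (T : Type*) [Ring T] : Subring T := (Int.castRingHom T).range

theorem primeSubring_le_center (T : Type*) [Ring T] : primeSubring T ≤ Subring.center T := by
  rintro _ ⟨n, rfl⟩
  exact intCast_mem _ n

/-- The prime subring is commutative; the ring operations are those inherited from `T`. -/
instance primeSubring.instCommRing (T : Type*) [Ring T] : CommRing (primeSubring T) :=
  { (primeSubring T).toRing with
    mul_comm := fun a b => Subtype.ext
      ((Subring.mem_center_iff.mp (primeSubring_le_center T b.2)) a.1) }

/-- `R` is a maximal subring of `T`: it is a proper (unital) subring, and no subring of `T`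
lies strictly between `R` and `T`. -/
def IsMaximalSubring {T : Type*} [Ring T] (R : Subring T) : Prop :=
  R ≠ ⊤ ∧ ¬ ∃ S : Subring T, R < S ∧ S < ⊤

/-! Suppose `T` has no maximal subring. Maximal subrings pull back along surjections, so no simple
factor `M_d(D)` of `T/J`, with `J` the Jacobson radical, has one. This rules out `d ≥ 2` (stabilizer
of a line) and noncommutative `D`: by dual bases, `D` is finitely generated over the centralizer of
a noncentral element, and Zorn applies. A field `D` not algebraic over a finite prime field is
algebraic over a PID (`ℤ` or `F[X]`) with a prime `π`, and a subring maximal for omitting `π⁻¹` is a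
maximal subring. So `T/J` is countable with `x ^ (n + 1) = x` for each `x`. Finite length makes `T`
countable; nilpotency of `J` gives `(t ^ (n + 1) - t) ^ k = 0`, hence integrality and, at `t = 2`,
nonzero characteristic. -/

theorem IsMaximalSubring.comap {T S : Type*} [Ring T] [Ring S] {f : T →+* S}
    (hf : Function.Surjective f) {R : Subring S} (hR : IsMaximalSubring R) :
    IsMaximalSubring (R.comap f) := by
  obtain ⟨hne, hmax⟩ := hR
  refine ⟨fun h => hne ?_, ?_⟩
  · rw [eq_top_iff]
    intro y _
    obtain ⟨x, rfl⟩ := hf y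
    have : x ∈ R.comap f := h ▸ Subring.mem_top x
    exact this
  · rintro ⟨Q, hRQ, hQ⟩
    have hker : ∀ {x y}, x ∈ Q → f x = f y → y ∈ Q := by
      intro x y hx hxy
      have : y - x ∈ R.comap f := by
        rw [Subring.mem_comap, map_sub, hxy, sub_self]
        exact R.zero_mem
      simpa using Q.add_mem (hRQ.le this) hx
    refine hmax ⟨Q.map f, ?_, ?_⟩
    · obtain ⟨x, hxQ, hxR⟩ := SetLike.exists_of_lt hRQ
      refine lt_of_le_of_ne (fun y hy => ?_) fun h => hxR ?_
      · obtain ⟨z, rfl⟩ := hf y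
        exact ⟨z, hRQ.le hy, rfl⟩
      · rw [Subring.mem_comap, h]
        exact ⟨x, hxQ, rfl⟩
    · refine lt_top_iff_ne_top.2 fun h => hQ.ne (eq_top_iff.2 fun y _ => ?_)
      have : f y ∈ Q.map f := h ▸ Subring.mem_top _
      obtain ⟨x, hx, hxy⟩ := this
      exact hker hx hxy

theorem exists_isMaximalSubring_of_surjective {T S : Type*} [Ring T] [Ring S] (f : T →+* S)
    (hf : Function.Surjective f) (h : ∃ R : Subring S, IsMaximalSubring R) :
    ∃ R : Subring T, IsMaximalSubring R :=
  let ⟨_, hR⟩ := h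
  ⟨_, hR.comap hf⟩

/-- Among the subrings above `R` that do not contain the finite set `s` there is a maximal one. -/
theorem Subring.exists_maximal_not_subset {T : Type*} [Ring T] (R : Subring T) {s : Set T}
    (hs : s.Finite) (hRs : ¬ s ⊆ R) :
    ∃ W : Subring T, R ≤ W ∧ ¬ s ⊆ W ∧ ∀ W' : Subring T, W < W' → s ⊆ W' := by
  obtain ⟨W, hRW, hW⟩ := zorn_le_nonempty₀ {W : Subring T | ¬ s ⊆ W} (fun c hc hchain y hy => by
    refine ⟨sSup c, fun hsub => ?_, fun z hz => le_sSup hz⟩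
    have hdir : DirectedOn (· ≤ ·) c := hchain.directedOn
    have hsub' : s ⊆ ⋃₀ ((fun W : Subring T => (W : Set T)) '' c) := by
      rw [Set.sUnion_image, ← Subring.coe_sSup_of_directedOn ⟨y, hy⟩ hdir]
      exact hsub
    obtain ⟨_, ⟨W, hWc, rfl⟩, hsW⟩ := DirectedOn.exists_mem_subset_of_finite_of_subset_sUnion
      (Set.Nonempty.image _ ⟨y, hy⟩) (by
        rintro _ ⟨A, hA, rfl⟩ _ ⟨B, hB, rfl⟩
        obtain ⟨C, hC, h1, h2⟩ := hdir A hA B hB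
        exact ⟨_, ⟨C, hC, rfl⟩, h1, h2⟩) hs hsub'
    exact hc hWc hsW) R hRs
  refine ⟨W, hRW, hW.1, fun W' h => ?_⟩
  by_contra hn
  exact h.not_ge (hW.2 hn h.le)

/-- A ring which is finitely generated over a proper subring has a maximal subring. -/
theorem exists_isMaximalSubring_of_closure_eq_top {T : Type*} [Ring T] {R : Subring T}
    (hR : R ≠ ⊤) {s : Set T} (hs : s.Finite)
    (hclosure : ∀ W : Subring T, R ≤ W → s ⊆ W → W = ⊤) :
    ∃ R : Subring T, IsMaximalSubring R := by
  obtain ⟨W, hRW, hsW, hW⟩ := R.exists_maximal_not_subset hs fun h => hR (hclosure R le_rfl h)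
  exact ⟨W, fun h => hsW (h ▸ Set.subset_univ _), fun ⟨W', h1, h2⟩ =>
    h2.ne (hclosure W' (hRW.trans h1.le) (hW W' h1))⟩

/-! ### Matrix rings -/

/-- The matrices over `D` that stabilise the line spanned by the `i₀`-th basis vector. -/
def Matrix.lineStabilizer (n D : Type*) [Fintype n] [DecidableEq n] [Ring D] (i₀ : n) :
    Subring (Matrix n n D) where
  carrier := {x | ∀ i, i ≠ i₀ → x i i₀ = 0}
  mul_mem' {x y} hx hy i hi := by
    rw [Matrix.mul_apply]
    refine Finset.sum_eq_zero fun j _ => ?_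
    by_cases hj : j = i₀
    · rw [hj, hx i hi, zero_mul]
    · rw [hy j hj, mul_zero]
  one_mem' i hi := Matrix.one_apply_ne hi
  add_mem' {x y} hx hy i hi := by rw [Matrix.add_apply, hx i hi, hy i hi, add_zero]
  zero_mem' _ _ := rfl
  neg_mem' {x} hx i hi := by rw [Matrix.neg_apply, hx i hi, neg_zero]

theorem Matrix.isMaximalSubring_lineStabilizer {n D : Type*} [Fintype n] [DecidableEq n]
    [DivisionRing D] {i₀ j₀ : n} (h : j₀ ≠ i₀) :
    IsMaximalSubring (Matrix.lineStabilizer n D i₀) := by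
  have hsingle : ∀ (i j : n) (d : D), j ≠ i₀ ∨ i = i₀ →
      Matrix.single i j d ∈ Matrix.lineStabilizer n D i₀ := by
    intro i j d hij k hk
    rcases hij with hj | rfl
    · exact Matrix.single_apply_of_col_ne _ _ hj _
    · exact Matrix.single_apply_of_row_ne hk.symm _ _ _
  refine ⟨fun htop => ?_, ?_⟩
  · have : Matrix.single j₀ i₀ (1 : D) ∈ Matrix.lineStabilizer n D i₀ := htop ▸ Subring.mem_top _
    simpa using this j₀ h
  · rintro ⟨S, hRS, hS⟩
    obtain ⟨x, hxS, hx⟩ := SetLike.exists_of_lt hRS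
    have : ∃ i, i ≠ i₀ ∧ x i i₀ ≠ 0 := by
      by_contra! hcon
      exact hx hcon
    obtain ⟨i, hi, hxi⟩ := this
    refine hS.ne (eq_top_iff.2 fun y _ => ?_)
    rw [Matrix.matrix_eq_sum_single y]
    refine S.sum_mem fun k _ => S.sum_mem fun j _ => ?_
    by_cases hj : j = i₀
    · subst hj
      -- Matrix units carry the nonzero entry `x i j` of the special column to position `(k, j)`,
      -- rescaled to `y k j`.
      have h1 := S.mul_mem (S.mul_mem (hRS.le (hsingle k i (y k j * (x i j)⁻¹) (Or.inl hi))) hxS)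
        (hRS.le (hsingle j j 1 (Or.inr rfl)))
      rwa [Matrix.single_mul_mul_single, mul_one, inv_mul_cancel_right₀ hxi] at h1
    · exact hRS.le (hsingle k j _ (Or.inl hj))

theorem Matrix.exists_isMaximalSubring {n D : Type*} [Fintype n] [DecidableEq n] [Nontrivial n]
    [DivisionRing D] : ∃ R : Subring (Matrix n n D), IsMaximalSubring R :=
  let ⟨_, _, h⟩ := exists_pair_ne n
  ⟨_, Matrix.isMaximalSubring_lineStabilizer h⟩

/-! ### Noncommutative division rings -/

/-- A finite-dimensional space of functions with values in a division ring has a finite set of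
points of evaluation together with a dual basis. -/
theorem Submodule.exists_dual_points {X D : Type*} [DivisionRing D] (M : Submodule D (X → D))
    [FiniteDimensional D M] :
    ∃ (s : Finset X) (m : X → X → D), (∀ x ∈ s, m x ∈ M) ∧ (∀ x ∈ s, m x x = 1) ∧
      (∀ x ∈ s, ∀ y ∈ s, y ≠ x → m x y = 0) ∧ ∀ f ∈ M, f = ∑ x ∈ s, f x • m x := by
  classical
  let V : Finset X → Submodule D M := fun s =>
    { carrier := {f | ∀ x ∈ s, f.1 x = 0}
      add_mem' := fun {f g} hf hg x hx => by simp [hf x hx, hg x hx]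
      zero_mem' := fun _ _ => rfl
      smul_mem' := fun c f hf x hx => by simp [hf x hx] }
  have hex : ∃ s : Finset X, ∀ f ∈ M, (∀ x ∈ s, f x = 0) → f = 0 := by
    obtain ⟨_, ⟨s, rfl⟩, hs⟩ := IsArtinian.set_has_minimal (Set.range V) ⟨_, ∅, rfl⟩
    refine ⟨s, fun f hf hfs => ?_⟩
    by_contra hne
    obtain ⟨x, hx⟩ := Function.ne_iff.1 hne
    refine hs _ ⟨insert x s, rfl⟩ (lt_of_le_of_ne (fun g hg y hy => hg y (by simp [hy])) fun h => ?_)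
    have hmem : (⟨f, hf⟩ : M) ∈ V s := hfs
    rw [← h] at hmem
    exact hx (hmem x (by simp))
  obtain ⟨s, hs, hmin⟩ := exists_minimal_of_wellFoundedLT
    (fun s : Finset X => ∀ f ∈ M, (∀ x ∈ s, f x = 0) → f = 0) hex
  have hdual : ∀ x ∈ s, ∃ g ∈ M, g x = 1 ∧ ∀ y ∈ s, y ≠ x → g y = 0 := by
    intro x hx
    have hfail : ¬ ∀ f ∈ M, (∀ y ∈ s.erase x, f y = 0) → f = 0 :=
      fun h => Finset.notMem_erase x s (hmin h (Finset.erase_subset x s) hx)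
    push Not at hfail
    obtain ⟨f, hf, hfs, hne⟩ := hfail
    have hfx : f x ≠ 0 := fun h => hne (hs f hf fun y hy => by
      by_cases hyx : y = x
      · rw [hyx, h]
      · exact hfs y (Finset.mem_erase.2 ⟨hyx, hy⟩))
    refine ⟨(f x)⁻¹ • f, M.smul_mem _ hf, by simp [hfx], fun y hy hyx => ?_⟩
    simp [hfs y (Finset.mem_erase.2 ⟨hyx, hy⟩)]
  choose! m hm hm1 hm0 using hdual
  refine ⟨s, m, hm, hm1, hm0, fun f hf => ?_⟩
  rw [← sub_eq_zero]
  refine hs _ (M.sub_mem hf (M.sum_mem fun x hx => M.smul_mem _ (hm x hx))) fun x hx => ?_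
  rw [Pi.sub_apply, Finset.sum_apply, Finset.sum_eq_single_of_mem x hx]
  · simp [hm1 x hx]
  · intro y hy hyx
    simp [hm0 y hy x hx hyx.symm]

/-- If `a` is algebraic over the center of a division ring `D`, then `D` is finitely generated
as a right module over the centralizer of `a`. -/
theorem DivisionRing.exists_finset_sum_mul_centralizer {D : Type*} [DivisionRing D] {a : D}
    (ha : IsIntegral (Subring.center D) a) :
    ∃ s : Finset D, ∀ y : D, ∃ c : D → D, (∀ x ∈ s, c x ∈ Subring.centralizer {a}) ∧
      y = ∑ x ∈ s, x * c x := by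
  classical
  obtain ⟨G, hG⟩ := ha.fg_adjoin_singleton
  -- The left `D`-span of the right multiplications by elements of `Z[a]`, `Z` the center. It
  -- contains the identity and is stable under `f ↦ f · a`.
  let M : Submodule D (D → D) := Submodule.span D ((fun b x => x * b) '' (G : Set D))
  have hfin : FiniteDimensional D M := FiniteDimensional.span_of_finite D (G.finite_toSet.image _)
  have hM : ∀ b ∈ Algebra.adjoin (Subring.center D) {a}, (fun x => x * b) ∈ M := by
    intro b hb
    rw [← Subalgebra.mem_toSubmodule, ← hG] at hb
    induction hb using Submodule.span_induction with
    | mem b hb => exact Submodule.subset_span ⟨b, hb, rfl⟩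
    | zero =>
      simp only [mul_zero]
      exact M.zero_mem
    | add b c _ _ hb hc =>
      simp only [mul_add]
      exact M.add_mem hb hc
    | smul z b _ hb =>
      convert M.smul_mem z.1 hb using 1
      funext x
      simp only [Pi.smul_apply, smul_eq_mul, Subring.smul_def, ← mul_assoc]
      rw [Subring.mem_center_iff.1 z.2 x]
  have hMa : ∀ f ∈ M, (fun x => f x * a) ∈ M := by
    intro f hf
    induction hf using Submodule.span_induction with
    | mem f hf =>
      obtain ⟨b, hb, rfl⟩ := hf
      have hb' : b ∈ Algebra.adjoin (Subring.center D) {a} := by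
        rw [← Subalgebra.mem_toSubmodule, ← hG]
        exact Submodule.subset_span hb
      simpa only [mul_assoc] using
        hM _ (mul_mem hb' (Algebra.self_mem_adjoin_singleton (Subring.center D) a))
    | zero =>
      simp only [Pi.zero_apply, zero_mul]
      exact M.zero_mem
    | add f g _ _ hf hg =>
      simp only [Pi.add_apply, add_mul]
      exact M.add_mem hf hg
    | smul z f _ hf =>
      simp only [Pi.smul_apply, smul_eq_mul, mul_assoc]
      exact M.smul_mem z hf
  obtain ⟨s, m, hm, hm1, hm0, hexp⟩ := M.exists_dual_points
  refine ⟨s, fun y => ⟨fun x => m x y, fun x hx => ?_, ?_⟩⟩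
  -- Expanding `m x · a` in the dual basis leaves only the coefficient `a` at `x`: `m x y * a = a *
  -- m x y`.
  · have h := congrFun (hexp _ (hMa _ (hm x hx))) y
    rw [Finset.sum_apply, Finset.sum_eq_single_of_mem x hx fun z hz hzx => by
      simp [hm0 x hx z hz hzx], hm1 x hx] at h
    rw [Subring.mem_centralizer_iff]
    rintro _ rfl
    simpa using h.symm
  · simpa using congrFun (hexp _ (hM 1 (one_mem _))) y

theorem DivisionRing.exists_isMaximalSubring_of_notMem_center {D : Type*} [DivisionRing D] {a : D}
    (ha : IsIntegral (Subring.center D) a) (hc : a ∉ Subring.center D) :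
    ∃ R : Subring D, IsMaximalSubring R := by
  obtain ⟨s, hs⟩ := DivisionRing.exists_finset_sum_mul_centralizer ha
  refine exists_isMaximalSubring_of_closure_eq_top (R := Subring.centralizer {a}) (fun h => hc ?_)
    s.finite_toSet fun W hW hsW => eq_top_iff.2 fun y _ => ?_
  · rw [Subring.centralizer_eq_top_iff_subset] at h
    exact h rfl
  · obtain ⟨c, hc, rfl⟩ := hs y
    exact W.sum_mem fun x hx => W.mul_mem (hsW hx) (hW (hc x hx))

/-! ### Fields -/

/-- A field algebraic over a principal ideal domain which is not a field has a maximal subring. -/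
theorem exists_isMaximalSubring_of_isAlgebraic_of_irreducible {A K : Type*} [CommRing A]
    [IsDomain A] [IsPrincipalIdealRing A] [Field K] [Algebra A K] [FaithfulSMul A K]
    [Algebra.IsAlgebraic A K] {π : A} (hπ : Irreducible π) :
    ∃ R : Subring K, IsMaximalSubring R := by
  have hinj := FaithfulSMul.algebraMap_injective A K
  set ϖ : K := algebraMap A K π with hϖ
  have hϖ0 : ϖ ≠ 0 := by simpa [hϖ] using hπ.ne_zero
  have hnot : ¬ ({ϖ⁻¹} : Set K) ⊆ (algebraMap A K).range := by
    rw [Set.singleton_subset_iff]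
    rintro ⟨y, hy⟩
    refine hπ.not_isUnit (IsUnit.of_mul_eq_one y (hinj ?_))
    rw [map_mul, hy, map_one, mul_inv_cancel₀ hϖ0]
  -- Every subring strictly above `W` contains `ϖ⁻¹`, so maximality reduces to `K = W[ϖ⁻¹]`, which
  -- is `hpow`.
  obtain ⟨W, hAW, hW, hmax⟩ := Subring.exists_maximal_not_subset _ (Set.finite_singleton _) hnot
  simp only [Set.singleton_subset_iff, SetLike.mem_coe] at hW hmax
  have hA : ∀ y, algebraMap A K y ∈ W := fun y => hAW ⟨y, rfl⟩
  -- Otherwise `ϖ` is a unit in the integral extension `W[x]`, hence already in `W`.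
  have hintcl : ∀ x : K, IsIntegral W x → x ∈ W := by
    intro x hx
    by_contra hxW
    have hmem : ϖ⁻¹ ∈ (Algebra.adjoin W {x}).toSubring := by
      refine hmax _ (lt_of_le_of_ne (fun w hw => ?_) fun h => hxW ?_)
      · exact (Algebra.adjoin W {x}).algebraMap_mem ⟨w, hw⟩
      · rw [h]
        exact Algebra.self_mem_adjoin_singleton W x
    have hint := Algebra.IsIntegral.adjoin (R := W) (S := {x}) (by simpa using hx)
    have hloc : IsLocalHom (algebraMap W (Algebra.adjoin W {x})) := inferInstance
    have hu : IsUnit (⟨ϖ, hA π⟩ : W) := hloc.map_nonunit _ <|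
      IsUnit.of_mul_eq_one ⟨ϖ⁻¹, hmem⟩ (Subtype.ext (mul_inv_cancel₀ hϖ0))
    obtain ⟨w, hw⟩ := hu.exists_right_inv
    have hw' : ϖ * w = 1 := congrArg Subtype.val hw
    rw [← eq_inv_of_mul_eq_one_right hw'] at hW
    exact hW w.2
  -- Otherwise `g ^ n * ϖ⁻¹ ∈ W` for some `n`, and a Bézout relation between `g ^ n` and `π` puts
  -- `ϖ⁻¹` in `W`.
  have hunit : ∀ g : A, IsCoprime g π → (algebraMap A K g)⁻¹ ∈ W := by
    intro g hg
    by_contra hgW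
    have hmem : ϖ⁻¹ ∈ (Algebra.adjoin W {(algebraMap A K g)⁻¹}).toSubring := by
      refine hmax _ (lt_of_le_of_ne (fun w hw => ?_) fun h => hgW ?_)
      · exact (Algebra.adjoin W {(algebraMap A K g)⁻¹}).algebraMap_mem ⟨w, hw⟩
      · rw [h]
        exact Algebra.self_mem_adjoin_singleton W _
    have hden : ∀ z ∈ Algebra.adjoin W {(algebraMap A K g)⁻¹},
        ∃ n : ℕ, algebraMap A K g ^ n * z ∈ W := by
      intro z hz
      induction hz using Algebra.adjoin_induction with
      | mem z hz =>
        rw [Set.mem_singleton_iff] at hz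
        refine ⟨1, ?_⟩
        by_cases hg0 : algebraMap A K g = 0
        · simp [hg0]
        · simp [hz, hg0]
      | algebraMap w => exact ⟨0, by rw [pow_zero, one_mul]; exact w.2⟩
      | add y z _ _ hy hz =>
        obtain ⟨m, hm⟩ := hy
        obtain ⟨n, hn⟩ := hz
        refine ⟨m + n, ?_⟩
        have := W.add_mem (W.mul_mem (W.pow_mem (hA g) n) hm) (W.mul_mem (W.pow_mem (hA g) m) hn)
        convert this using 1
        ring
      | mul y z _ _ hy hz =>
        obtain ⟨m, hm⟩ := hy
        obtain ⟨n, hn⟩ := hz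
        refine ⟨m + n, ?_⟩
        convert W.mul_mem hm hn using 1
        ring
    obtain ⟨n, hn⟩ := hden _ hmem
    obtain ⟨u, v, huv⟩ := hg.pow_left (m := n)
    refine hW ?_
    have huv' := congrArg (algebraMap A K) huv
    rw [map_add, map_mul, map_mul, map_pow, map_one, ← hϖ] at huv'
    have : ϖ⁻¹ = algebraMap A K u * (algebraMap A K g ^ n * ϖ⁻¹) + algebraMap A K v := by
      rw [← mul_assoc, ← mul_inv_cancel_right₀ hϖ0 (algebraMap A K v), ← add_mul, huv', one_mul]
    rw [this]
    exact W.add_mem (W.mul_mem (hA u) hn) (hA v)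
  have hpow : ∀ x : K, ∃ k : ℕ, ϖ ^ k * x ∈ W := by
    intro x
    obtain ⟨y, hy0, hy⟩ := (Algebra.IsAlgebraic.isAlgebraic (R := A) x).exists_integral_multiple
    -- Only the power of `π` in the denominator matters: the cofactor `g` is invertible in `W`.
    obtain ⟨k, g, hg, rfl⟩ := WfDvdMonoid.max_power_factor hy0 hπ
    have hg0 : algebraMap A K g ≠ 0 := by
      have := right_ne_zero_of_mul hy0
      simpa using this
    refine ⟨k, ?_⟩
    have hmem : (π ^ k * g) • x ∈ W := hintcl _ <| by
      let : Algebra A W := ((algebraMap A K).codRestrict W hA).toAlgebra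
      have : IsScalarTower A W K := IsScalarTower.of_algebraMap_eq fun _ => rfl
      exact hy.tower_top
    have hg' := hunit g ((hπ.coprime_iff_not_dvd.2 hg).symm)
    have := W.mul_mem hg' hmem
    rw [Algebra.smul_def, map_mul, map_pow, mul_right_comm, mul_comm _ (algebraMap A K g),
      inv_mul_cancel_left₀ hg0] at this
    exact this
  refine ⟨W, fun h => hW (h ▸ Subring.mem_top _), ?_⟩
  rintro ⟨W', hWW', hW'⟩
  refine hW'.ne (eq_top_iff.2 fun x _ => ?_)
  obtain ⟨k, hk⟩ := hpow x
  have := W'.mul_mem (W'.pow_mem (hmax W' hWW') k) (hWW'.le hk)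
  rwa [inv_pow, inv_mul_cancel_left₀ (pow_ne_zero k hϖ0)] at this

open scoped IntermediateField.algebraAdjoinAdjoin in
-- Adjoining all but one element `t` of a transcendence basis to `k` gives `F` with `K` algebraic
-- over `F[t]`, a polynomial ring in which `t` is prime.
theorem exists_isMaximalSubring_of_transcendental (k K : Type*) [Field k] [Field K] [Algebra k K]
    [htr : Algebra.Transcendental k K] : ∃ R : Subring K, IsMaximalSubring R := by
  obtain ⟨X, hX⟩ := exists_isTranscendenceBasis k K
  obtain ⟨t, ht⟩ := hX.nonempty_iff_transcendental.2 htr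
  let S : Set K := X \ {t}
  let F := IntermediateField.adjoin k S
  have htF : Transcendental F t := by
    have h := hX.1.transcendental_adjoin (s := {⟨t, ht⟩}ᶜ) (i := ⟨t, ht⟩) (by simp)
    have himage : ((↑) : X → K) '' {⟨t, ht⟩}ᶜ = S := by
      ext y
      simp [S]
    rw [himage] at h
    exact fun halg => h ((IsFractionRing.isAlgebraic_iff (Algebra.adjoin k S) F K).2 halg)
  let : Algebra (Polynomial F) K := (Polynomial.aeval t).toRingHom.toAlgebra
  have hmap : ∀ p : Polynomial F, algebraMap (Polynomial F) K p = Polynomial.aeval t p :=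
    fun _ => rfl
  have hinj : Function.Injective (algebraMap (Polynomial F) K) :=
    transcendental_iff_injective.1 htF
  have : FaithfulSMul (Polynomial F) K := (faithfulSMul_iff_algebraMap_injective _ _).2 hinj
  have hrange : ∀ y ∈ Algebra.adjoin k (Set.range ((↑) : X → K)),
      y ∈ (algebraMap (Polynomial F) K).range := by
    intro y hy
    induction hy using Algebra.adjoin_induction with
    | mem y hy =>
      obtain ⟨⟨y, hyX⟩, rfl⟩ := hy
      by_cases hyt : y = t
      · exact ⟨Polynomial.X, by simp [hmap, hyt]⟩
      · exact ⟨Polynomial.C ⟨y, IntermediateField.subset_adjoin k S ⟨hyX, hyt⟩⟩, by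
          simp [hmap]⟩
    | algebraMap r => exact ⟨Polynomial.C (algebraMap k F r), by simp [hmap]⟩
    | add y z _ _ hy hz => exact add_mem hy hz
    | mul y z _ _ hy hz => exact mul_mem hy hz
  have : Algebra.IsAlgebraic (Polynomial F) K := by
    have := hX.isAlgebraic
    let e := RingEquiv.ofBijective (algebraMap (Polynomial F) K).rangeRestrict
      ⟨fun a b h => hinj (congrArg Subtype.val h), RingHom.rangeRestrict_surjective _⟩
    let φ : Algebra.adjoin k (Set.range ((↑) : X → K)) →+* Polynomial F :=
      e.symm.toRingHom.comp ((Algebra.adjoin k (Set.range ((↑) : X → K))).val.toRingHom.codRestrict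
        _ fun y => hrange y.1 y.2)
    have hφ : ∀ y, algebraMap (Polynomial F) K (φ y) = y.1 := fun y =>
      congrArg Subtype.val (e.apply_symm_apply ⟨y.1, hrange y.1 y.2⟩)
    let : Algebra (Algebra.adjoin k (Set.range ((↑) : X → K))) (Polynomial F) := φ.toAlgebra
    have : IsScalarTower (Algebra.adjoin k (Set.range ((↑) : X → K))) (Polynomial F) K :=
      IsScalarTower.of_algebraMap_eq fun y => (hφ y).symm
    refine Algebra.IsAlgebraic.extendScalars (R := Algebra.adjoin k (Set.range ((↑) : X → K)))
      fun a b h => Subtype.ext ?_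
    rw [← hφ, ← hφ]
    exact congrArg _ h
  exact exists_isMaximalSubring_of_isAlgebraic_of_irreducible (A := Polynomial F)
    Polynomial.irreducible_X

/-- A field without maximal subrings is algebraic over a finite prime field. -/
theorem Field.isAlgebraic_zmod_of_not_exists_isMaximalSubring {K : Type*} [Field K]
    (h : ¬ ∃ R : Subring K, IsMaximalSubring R) :
    ∃ p : ℕ, p.Prime ∧ ∃ _ : Algebra (ZMod p) K, Algebra.IsAlgebraic (ZMod p) K := by
  obtain ⟨p, hp⟩ := CharP.exists K
  rcases CharP.char_is_prime_or_zero K p with hpp | rfl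
  · have := Fact.mk hpp
    let := ZMod.algebra K p
    refine ⟨p, hpp, inferInstance, ?_⟩
    by_contra halg
    have := Algebra.transcendental_iff_not_isAlgebraic.2 halg
    exact h (exists_isMaximalSubring_of_transcendental (ZMod p) K)
  · have := CharP.charP_to_charZero K
    by_cases halg : Algebra.IsAlgebraic ℚ K
    · have : Algebra.IsAlgebraic ℤ K := (IsFractionRing.comap_isAlgebraic_iff (K := ℚ)).2 halg
      exact absurd (exists_isMaximalSubring_of_isAlgebraic_of_irreducible (A := ℤ)
        Int.prime_two.irreducible) h
    · have := Algebra.transcendental_iff_not_isAlgebraic.2 halg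
      exact absurd (exists_isMaximalSubring_of_transcendental ℚ K) h

/-! ### Countable periodic rings -/

/-- A countable ring in which every element satisfies an equation `x ^ (n + 1) = x`. -/
def IsCountablePeriodicRing (S : Type*) [Ring S] : Prop :=
  Countable S ∧ ∀ x : S, ∃ n : ℕ, 0 < n ∧ x ^ (n + 1) = x

theorem IsCountablePeriodicRing.of_ringEquiv {S S' : Type*} [Ring S] [Ring S'] (e : S ≃+* S')
    (h : IsCountablePeriodicRing S) : IsCountablePeriodicRing S' := by
  have := h.1
  refine ⟨e.symm.injective.countable, fun x => ?_⟩
  obtain ⟨n, hn, hx⟩ := h.2 (e.symm x)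
  exact ⟨n, hn, e.symm.injective (by rw [map_pow, hx])⟩

theorem pow_mul_add_one_eq_self {M : Type*} [Monoid M] {x : M} {n : ℕ} (h : x ^ (n + 1) = x)
    (k : ℕ) : x ^ (n * k + 1) = x := by
  induction k with
  | zero => simp
  | succ k ih => rw [show n * (k + 1) + 1 = (n * k + 1) + n by ring, pow_add, ih, ← pow_succ', h]

theorem IsCountablePeriodicRing.pi {ι : Type*} [Fintype ι] {S : ι → Type*} [∀ i, Ring (S i)]
    (h : ∀ i, IsCountablePeriodicRing (S i)) : IsCountablePeriodicRing (∀ i, S i) := by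
  classical
  have := fun i => (h i).1
  refine ⟨inferInstance, fun x => ?_⟩
  choose n hn hx using fun i => (h i).2 (x i)
  refine ⟨∏ i, n i, Finset.prod_pos fun i _ => hn i, funext fun i => ?_⟩
  obtain ⟨k, hk⟩ := Finset.dvd_prod_of_mem n (Finset.mem_univ i)
  rw [hk]
  exact pow_mul_add_one_eq_self (hx i) k

theorem isCountablePeriodicRing_of_isAlgebraic {K : Type*} [Field K] (p : ℕ) [Fact p.Prime]
    [Algebra (ZMod p) K] [Algebra.IsAlgebraic (ZMod p) K] : IsCountablePeriodicRing K := by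
  refine ⟨?_, fun x => ?_⟩
  · rw [← Set.countable_univ_iff]
    exact (Algebraic.countable (ZMod p) K).mono fun x _ => Algebra.IsAlgebraic.isAlgebraic x
  · have : FiniteDimensional (ZMod p) (IntermediateField.adjoin (ZMod p) {x}) :=
      IntermediateField.adjoin.finiteDimensional (Algebra.IsIntegral.isIntegral x)
    have : Finite (IntermediateField.adjoin (ZMod p) {x}) := Module.finite_of_finite (ZMod p)
    have := Fintype.ofFinite (IntermediateField.adjoin (ZMod p) {x})
    have hx := FiniteField.pow_card (IntermediateField.AdjoinSimple.gen (ZMod p) x)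
    have hcard := Fintype.one_lt_card (α := IntermediateField.adjoin (ZMod p) {x})
    refine ⟨Fintype.card (IntermediateField.adjoin (ZMod p) {x}) - 1, by omega, ?_⟩
    rw [Nat.sub_add_cancel hcard.le]
    simpa using congrArg Subtype.val hx

/-! ### From division rings to the Artinian ring -/

theorem DivisionRing.isCountablePeriodicRing_of_not_exists_isMaximalSubring {D : Type*}
    [hD : DivisionRing D] (hint : ∀ a : D, IsIntegral (Subring.center D) a)
    (h : ¬ ∃ R : Subring D, IsMaximalSubring R) : IsCountablePeriodicRing D := by
  have hcomm : ∀ a b : D, a * b = b * a := by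
    intro a b
    by_contra hab
    refine h (exists_isMaximalSubring_of_notMem_center (hint b) fun hb => hab ?_)
    exact Subring.mem_center_iff.1 hb a
  let : Field D := { hD with mul_comm := hcomm }
  obtain ⟨p, hp, _, _⟩ := Field.isAlgebraic_zmod_of_not_exists_isMaximalSubring h
  have := Fact.mk hp
  exact isCountablePeriodicRing_of_isAlgebraic p

theorem isIntegral_center_of_surjective {T S : Type*} [Ring T] [Ring S] {f : T →+* S}
    (hf : Function.Surjective f) (hT : (Subring.center T).subtype.IsIntegral) (x : S) :
    IsIntegral (Subring.center S) x := by
  obtain ⟨t, rfl⟩ := hf x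
  obtain ⟨p, hp, hpt⟩ := hT t
  let φ : Subring.center T →+* Subring.center S :=
    (f.comp (Subring.center T).subtype).codRestrict _ fun z => Subring.mem_center_iff.2 fun y => by
      obtain ⟨y, rfl⟩ := hf y
      simp only [RingHom.comp_apply, Subring.subtype_apply, ← map_mul]
      rw [Subring.mem_center_iff.1 z.2 y]
  refine ⟨p.map φ, hp.map φ, ?_⟩
  rw [Polynomial.eval₂_map]
  have := congrArg f hpt
  rw [Polynomial.hom_eval₂, map_zero] at this
  exact this

theorem isCountablePeriodicRing_quotient_jacobson {T : Type*} [Ring T] [IsArtinianRing T]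
    (hT : (Subring.center T).subtype.IsIntegral) (h : ¬ ∃ R : Subring T, IsMaximalSubring R) :
    IsCountablePeriodicRing (T ⧸ Ring.jacobson T) := by
  obtain ⟨n, D, d, _, _, ⟨e⟩⟩ :=
    IsSemisimpleRing.exists_ringEquiv_pi_matrix_divisionRing (T ⧸ Ring.jacobson T)
  refine .of_ringEquiv e.symm (.pi fun i => ?_)
  let f : T →+* Matrix (Fin (d i)) (Fin (d i)) (D i) :=
    (Pi.evalRingHom _ i).comp (e.toRingHom.comp (Ideal.Quotient.mk (Ring.jacobson T)))
  have hf : Function.Surjective f :=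
    (Function.surjective_eval i).comp (e.surjective.comp Ideal.Quotient.mk_surjective)
  rcases subsingleton_or_nontrivial (Fin (d i)) with hs | hn
  · have : Unique (Fin (d i)) := Unique.mk' _
    obtain ⟨u⟩ : Nonempty (Matrix (Fin (d i)) (Fin (d i)) (D i) ≃+* D i) := by
      -- Matrix multiplication depends on the `Fintype` instance, which has to be the one derived
      -- from `Unique`.
      rw [Subsingleton.elim (Fin.fintype (d i)) Unique.fintype]
      exact ⟨Matrix.uniqueRingEquiv⟩
    refine .of_ringEquiv u.symm ?_
    have huf : Function.Surjective (u.toRingHom.comp f) := u.surjective.comp hf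
    exact DivisionRing.isCountablePeriodicRing_of_not_exists_isMaximalSubring
      (isIntegral_center_of_surjective huf hT)
      fun hR => h (exists_isMaximalSubring_of_surjective _ huf hR)
  · exact absurd (exists_isMaximalSubring_of_surjective f hf Matrix.exists_isMaximalSubring) h

/-- Each simple factor is `R ⧸ I` with `I` a maximal left ideal containing the radical, hence
countable; extensions of countable modules are countable. -/
theorem IsFiniteLength.countable {R M : Type*} [Ring R] [Countable (R ⧸ Ring.jacobson R)]
    [AddCommGroup M] [Module R M] (h : IsFiniteLength R M) : Countable M := by
  induction h with
  | of_subsingleton => infer_instance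
  | @of_simple_quotient M _ _ N hs _ ih =>
    have : Countable (M ⧸ N) := by
      obtain ⟨I, hI, ⟨e⟩⟩ := isSimpleModule_iff_quot_maximal.1 hs
      have hsurj := Submodule.factor_surjective (Ring.jacobson_le_of_isMaximal I)
      have : Countable (R ⧸ I) := hsurj.countable
      exact e.injective.countable
    have : Countable (M ⧸ N.toAddSubgroup) := this
    have : Countable N.toAddSubgroup := ih
    exact (AddSubgroup.addGroupEquivQuotientProdAddSubgroup
      (s := N.toAddSubgroup)).injective.countable

theorem exists_isNilpotent_pow_sub_self {T : Type*} [Ring T] [IsArtinianRing T]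
    (h : IsCountablePeriodicRing (T ⧸ Ring.jacobson T)) (t : T) :
    ∃ n : ℕ, 0 < n ∧ IsNilpotent (t ^ (n + 1) - t) := by
  obtain ⟨n, hn, ht⟩ := h.2 (Ideal.Quotient.mk _ t)
  refine ⟨n, hn, ?_⟩
  have hmem : t ^ (n + 1) - t ∈ Ring.jacobson T := by
    rw [← Ideal.Quotient.eq_zero_iff_mem, map_sub, map_pow, ht, sub_self]
  obtain ⟨k, hk⟩ := IsSemiprimaryRing.isNilpotent (R := T)
  refine ⟨k, ?_⟩
  have := Ideal.pow_mem_pow hmem k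
  rwa [hk] at this

theorem theorem4p7 (T : Type*) [Ring T] [Nontrivial T]
    (hArt : IsArtinianRing T)
    (hInt : (Subring.center T).subtype.IsIntegral) :
    (∃ R : Subring T, IsMaximalSubring R) ∨
      (Countable T ∧
        ∃ n : ℕ, n ≠ 0 ∧ CharP T n ∧ (primeSubring T).subtype.IsIntegral) := by
  refine or_iff_not_imp_left.2 fun h => ?_
  have hJ := isCountablePeriodicRing_quotient_jacobson hInt h
  refine ⟨?_, ringChar T, ?_, inferInstance, fun t => ?_⟩
  · have := hJ.1
    exact ((isArtinianRing_iff_isFiniteLength T).1 hArt).countable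
  · obtain ⟨n, hn, k, hk⟩ := exists_isNilpotent_pow_sub_self hJ 2
    have hlt : 2 < 2 ^ (n + 1) := by
      calc 2 = 2 ^ 1 := rfl
        _ < 2 ^ (n + 1) := Nat.pow_lt_pow_right one_lt_two (by omega)
    -- A positive integer, since `n > 0`, that vanishes in `T`.
    have hcast : (((2 ^ (n + 1) - 2) ^ k : ℕ) : T) = 0 := by
      rw [Nat.cast_pow, Nat.cast_sub hlt.le, Nat.cast_pow, Nat.cast_ofNat, hk]
    intro h0
    have := ringChar.dvd hcast
    rw [h0, zero_dvd_iff] at this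
    exact (pow_pos (Nat.sub_pos_of_lt hlt) k).ne' this
  · obtain ⟨n, hn, k, hk⟩ := exists_isNilpotent_pow_sub_self hJ t
    -- Monic because `n > 0` makes `X ^ (n + 1)` the leading term.
    have hmonic : ((Polynomial.X ^ (n + 1) - Polynomial.X : Polynomial ℤ) ^ k).Monic :=
      (Polynomial.monic_X_pow_sub
        (Polynomial.degree_X_le.trans_lt (by exact_mod_cast Nat.succ_lt_succ hn))).pow k
    refine ⟨_, hmonic.map (Int.castRingHom (primeSubring T)), ?_⟩
    rw [Polynomial.eval₂_map, RingHom.ext_int ((primeSubring T).subtype.comp _) (algebraMap ℤ T),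
      ← Polynomial.aeval_def]
    simpa using hk
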